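/- Let $\mathsf{TopStoch}$ be the category whose objects are topological spaces and whose morphisms $k : X \to Y$ are the continuous Markov kernels: for each $x \in X$, $k(\cdot\,|\,x)$ is a Borel probability measure on $Y$ that is $\tau$-smooth (that is, $k(\bigcup\mathcal D\,|\,x) = \sup_{U\in\mathcal D} k(U|x)$ for every upward directed family $\mathcal D$ of open sets), and for each open $U \subseteq Y$ the function $x \mapsto k(U|x)$ is lower semicontinuous on $X$. Composition is $(l\circ k)(A|x)=\int l(A|y)\,k(dy|x)$, identities are Dirac kernels, $X\otimes Y$ is the product topological space, and $(k\otimes l)(\cdot\,|\,x,u)$ is the unique $\tau$-smooth Borel probability measure on the product space with $(k\otimes l)(A\times B\,|\,x,u)=k(A|x)\,l(B|u)$ for Borel $A, B$; the unit is the one-point space $I$, and swap, copy $\Delta_X$ and discard are the Dirac kernels of the evident continuous maps. This is a Markov category. A morphism $f : X \to Y$ is deterministic if $\Delta_Y\circ f=(f\otimes f)\circ\Delta_X$. A group in a Markov category is an object $G$ with deterministic morphisms $G\otimes G\to G$, $I\to G$, $G\to G$ (multiplication, unit, inversion) satisfying the usual group axioms written with copy and discard; an action of $G$ on $X$ is a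 deterministic morphism $\alpha : G\otimes X\to X$ satisfying the usual associativity and unit axioms; the trivial action $\mathrm{triv} : G\otimes X\to X$ discards $G$. An orbit map for $\alpha$ is a deterministic morphism $q : X\to Q$ which is a coequaliser of $\alpha,\mathrm{triv} : G\otimes X\rightrightarrows X$, and such that for every object $Y$ this coequaliser is preserved by $(-)\otimes Y$, that is, $q\otimes \mathrm{id}_Y$ is a coequaliser of $\alpha\otimes \mathrm{id}_Y$ and $\mathrm{triv}\otimes \mathrm{id}_Y$. Theorem. Every action $\alpha : G\otimes X\to X$ of a group $G$ on an object $X$ in $\mathsf{TopStoch}$ admits an orbit map. More precisely, call an open set $U\subseteq X$ invariant if $\alpha(U|g,x)=1$ for all $g\in G$ and $x\in U$; the invariant open sets form a topology on the set $X$. Let $X/G$ be the set $X$ with this topology. Then the Dirac kernel $q : X\to X/G$, $q(A|x)=\delta_x(A)$, is an orbit map for $\alpha$. -/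

import Mathlib

open CategoryTheory MeasureTheory ProbabilityTheory
open scoped ENNReal MonoidalCategory ComonObj

universe v u

/-! ### Groups, actions and orbit maps in a Markov category -/

section MarkovCategory

variable {C : Type u} [Category.{v} C] [MonoidalCategory C] [MarkovCategory C]

/-- A group structure on an object `G` of a Markov category: deterministic multiplication, unit
and inversion, with the group axioms expressed through copying and discarding. -/
class MarkovGroup (G : C) where
  mul : G ⊗ G ⟶ G
  one : 𝟙_ C ⟶ G
  inv : G ⟶ G
  mul_deterministic : Deterministic mul
  one_deterministic : Deterministic one
  inv_deterministic : Deterministic inv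
  mul_assoc : mul ▷ G ≫ mul = (α_ G G G).hom ≫ G ◁ mul ≫ mul
  one_mul : one ▷ G ≫ mul = (λ_ G).hom
  mul_one : G ◁ one ≫ mul = (ρ_ G).hom
  inv_mul : Δ[G] ≫ inv ▷ G ≫ mul = ε[G] ≫ one
  mul_inv : Δ[G] ≫ G ◁ inv ≫ mul = ε[G] ≫ one

/-- `act : G ⊗ X ⟶ X` is an action of the group `G` on `X`. -/
structure IsMarkovAction {G X : C} [MarkovGroup G] (act : G ⊗ X ⟶ X) : Prop where
  deterministic : Deterministic act
  assoc : G ◁ act ≫ act = (α_ G G X).inv ≫ MarkovGroup.mul ▷ X ≫ act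
  unit : MarkovGroup.one ▷ X ≫ act = (λ_ X).hom

/-- The trivial action of `G` on `X`: discard `G`. -/
def trivialAction (G X : C) : G ⊗ X ⟶ X := ε[G] ▷ X ≫ (λ_ X).hom

/-- The fork `f, g : A ⇉ B ⟶ Q` is a coequaliser diagram. -/
def IsCoequaliser {A B Q : C} (f g : A ⟶ B) (q : B ⟶ Q) : Prop :=
  ∃ w : f ≫ q = g ≫ q, Nonempty (Limits.IsColimit (Limits.Cofork.ofπ q w))

/-- `q` is an orbit map for `act`: it is deterministic, it is a coequaliser of `act` and the
trivial action, and this coequaliser is preserved by `(-) ⊗ Y` for every `Y`. -/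
structure IsOrbitMap {G X Q : C} (act : G ⊗ X ⟶ X) (q : X ⟶ Q) : Prop where
  deterministic : Deterministic q
  coequaliser : IsCoequaliser act (trivialAction G X) q
  preserved : ∀ Y : C, IsCoequaliser (act ▷ Y) (trivialAction G X ▷ Y) (q ▷ Y)

end MarkovCategory

/-! ### τ-smooth measures and lower semicontinuous kernels -/

section Borel

/- In this section every topological space carries its Borel σ-algebra; in particular a product
carries the Borel σ-algebra of the product topology. -/
attribute [local instance 2000] borel

/-- A Borel measure is τ-smooth if it is continuous along directed unions of open sets. -/
def IsTauSmooth {X : Type*} [TopologicalSpace X] (μ : Measure X) : Prop :=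
  ∀ D : Set (Set X), (∀ U ∈ D, IsOpen U) → DirectedOn (· ⊆ ·) D →
    μ (⋃₀ D) = ⨆ U ∈ D, μ U

/-- A continuous Markov kernel between topological spaces: a Markov kernel for the Borel
σ-algebras, with τ-smooth values, such that `x ↦ k(U|x)` is lower semicontinuous for every
open `U`. -/
structure ContKernel (X Y : Type*) [TopologicalSpace X] [TopologicalSpace Y] where
  kernel : Kernel X Y
  isMarkov : IsMarkovKernel kernel
  tauSmooth : ∀ x, IsTauSmooth (kernel x)
  lsc : ∀ U : Set Y, IsOpen U → LowerSemicontinuous fun x => kernel x U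

attribute [instance] ContKernel.isMarkov

variable {X Y Z W : Type*} [TopologicalSpace X] [TopologicalSpace Y] [TopologicalSpace Z]
  [TopologicalSpace W]

lemma borelMeasurable {f : X → Y} (hf : Continuous f) : Measurable f :=
  hf.borel_measurable

lemma IsOpen.borelMeasurableSet {U : Set X} (h : IsOpen U) : MeasurableSet U :=
  MeasurableSpace.measurableSet_generateFrom h

lemma measure_eq_of_open {μ ν : Measure X} [IsProbabilityMeasure μ] [IsProbabilityMeasure ν]
    (h : ∀ U, IsOpen U → μ U = ν U) : μ = ν :=
  ext_of_generate_finite {U | IsOpen U} rfl isPiSystem_isOpen h (by simp)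

lemma IsTauSmooth.map {μ : Measure X} (hμ : IsTauSmooth μ) {f : X → Y} (hf : Continuous f) :
    IsTauSmooth (μ.map f) := by
  intro D hD hdir
  have hm := borelMeasurable hf
  rw [Measure.map_apply hm (isOpen_sUnion hD).borelMeasurableSet]
  have h1 : f ⁻¹' (⋃₀ D) = ⋃₀ ((fun U => f ⁻¹' U) '' D) := by
    ext x; simp
  rw [h1, hμ]
  · rw [iSup_image]
    refine iSup_congr fun U => iSup_congr fun hU => ?_
    rw [Measure.map_apply hm (hD U hU).borelMeasurableSet]
  · rintro _ ⟨U, hU, rfl⟩; exact (hD U hU).preimage hf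
  · rintro _ ⟨U, hU, rfl⟩ _ ⟨V, hV, rfl⟩
    obtain ⟨T, hT, h1, h2⟩ := hdir U hU V hV
    exact ⟨_, ⟨T, hT, rfl⟩, Set.preimage_mono h1, Set.preimage_mono h2⟩

lemma isTauSmooth_dirac (x : X) : IsTauSmooth (Measure.dirac x) := by
  intro D hD hdir
  rw [Measure.dirac_apply' _ (isOpen_sUnion hD).borelMeasurableSet]
  apply le_antisymm
  · by_cases hx : x ∈ ⋃₀ D
    · obtain ⟨U, hU, hxU⟩ := hx
      refine le_trans ?_ (le_iSup₂ (f := fun U (_ : U ∈ D) => Measure.dirac x U) U hU)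
      rw [Measure.dirac_apply' _ (hD U hU).borelMeasurableSet]
      simp [hxU, Set.indicator]
      split_ifs <;> simp
    · simp [hx]
  · refine iSup₂_le fun U hU => ?_
    rw [Measure.dirac_apply' _ (hD U hU).borelMeasurableSet]
    exact Set.indicator_le_indicator_of_subset (Set.subset_sUnion_of_mem hU) (by simp) x

/-- Lower semicontinuity on open sets already gives measurability. -/
def ContKernel.ofFun (k : X → Measure Y) (hp : ∀ x, IsProbabilityMeasure (k x))
    (hs : ∀ x, IsTauSmooth (k x))
    (hl : ∀ U : Set Y, IsOpen U → LowerSemicontinuous fun x => k x U) : ContKernel X Y where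
  kernel := ⟨k, Measurable.measure_of_isPiSystem_of_isProbabilityMeasure
    (S := {U | IsOpen U}) rfl isPiSystem_isOpen fun U hU => by
      have : BorelSpace X := ⟨rfl⟩
      exact (hl U hU).measurable⟩
  isMarkov := ⟨hp⟩
  tauSmooth := hs
  lsc := hl

@[simp] lemma ContKernel.ofFun_apply (k : X → Measure Y) (hp hs hl) (x : X) :
    (ContKernel.ofFun k hp hs hl).kernel x = k x := rfl

lemma ContKernel.ext_open {k l : ContKernel X Y}
    (h : ∀ x U, IsOpen U → k.kernel x U = l.kernel x U) : k = l := by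
  cases k with | mk k hk _ _ => cases l with | mk l hl _ _ =>
  have : k = l := by
    ext1 x
    exact measure_eq_of_open (h x)
  subst this; rfl

lemma ContKernel.ext_apply {k l : ContKernel X Y}
    (h : ∀ x, k.kernel x = l.kernel x) : k = l :=
  ContKernel.ext_open fun x U _ => by rw [h x]

/-- The level-set approximation of the integral of a `[0,1]`-valued function. -/
lemma lintegral_eq_iSup_levels (μ : Measure X) [IsProbabilityMeasure μ] (f : X → ℝ≥0∞)
    (hf : LowerSemicontinuous f) (h1 : ∀ x, f x ≤ 1) :
    ∫⁻ x, f x ∂μ = ⨆ n : ℕ, ∑ k ∈ Finset.range (n + 1),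
      ((n + 1 : ℕ) : ℝ≥0∞)⁻¹ * μ {x | ((k + 1 : ℕ) : ℝ≥0∞) * ((n + 1 : ℕ) : ℝ≥0∞)⁻¹ < f x} := by
  have hopen : ∀ t : ℝ≥0∞, MeasurableSet {x | t < f x} := fun t =>
    (hf.isOpen_preimage t).borelMeasurableSet
  have hint : ∀ n : ℕ, ∑ k ∈ Finset.range (n + 1),
      ((n + 1 : ℕ) : ℝ≥0∞)⁻¹ * μ {x | ((k + 1 : ℕ) : ℝ≥0∞) * ((n + 1 : ℕ) : ℝ≥0∞)⁻¹ < f x}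
      = ∫⁻ x, ∑ k ∈ Finset.range (n + 1), ((n + 1 : ℕ) : ℝ≥0∞)⁻¹ *
        Set.indicator {x | ((k + 1 : ℕ) : ℝ≥0∞) * ((n + 1 : ℕ) : ℝ≥0∞)⁻¹ < f x} 1 x ∂μ := by
    intro n
    rw [lintegral_finsetSum _ fun k _ => (measurable_one.indicator (hopen _)).const_mul _]
    refine Finset.sum_congr rfl fun k _ => ?_
    rw [lintegral_const_mul _ (measurable_one.indicator (hopen _)),
      lintegral_indicator_one (hopen _)]
  have hpt : ∀ (n : ℕ) (x : X), ∑ k ∈ Finset.range (n + 1), ((n + 1 : ℕ) : ℝ≥0∞)⁻¹ *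
        Set.indicator {x | ((k + 1 : ℕ) : ℝ≥0∞) * ((n + 1 : ℕ) : ℝ≥0∞)⁻¹ < f x} 1 x ≤ f x ∧
      f x ≤ ∑ k ∈ Finset.range (n + 1), ((n + 1 : ℕ) : ℝ≥0∞)⁻¹ *
        Set.indicator {x | ((k + 1 : ℕ) : ℝ≥0∞) * ((n + 1 : ℕ) : ℝ≥0∞)⁻¹ < f x} 1 x
        + ((n + 1 : ℕ) : ℝ≥0∞)⁻¹ := by
    intro n x
    have hfx : f x ≠ ∞ := ne_top_of_le_ne_top ENNReal.one_ne_top (h1 x)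
    obtain ⟨r, hr⟩ : ∃ r : NNReal, f x = r := ⟨(f x).toNNReal, (ENNReal.coe_toNNReal hfx).symm⟩
    have hr1 : r ≤ 1 := by have := h1 x; rw [hr] at this; exact_mod_cast this
    have hN : (0 : NNReal) < ((n + 1 : ℕ) : NNReal) := by positivity
    have hfil : (Finset.range (n + 1)).filter
        (fun k => ((k + 1 : ℕ) : ℝ≥0∞) * ((n + 1 : ℕ) : ℝ≥0∞)⁻¹ < f x)
        = Finset.range (⌈r * ((n + 1 : ℕ) : NNReal)⌉₊ - 1) := by
      have hc : ⌈r * ((n + 1 : ℕ) : NNReal)⌉₊ ≤ n + 1 := by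
        rw [Nat.ceil_le]; exact mul_le_of_le_one_left hN.le hr1
      ext k
      have : ((k + 1 : ℕ) : ℝ≥0∞) * ((n + 1 : ℕ) : ℝ≥0∞)⁻¹ < f x ↔
          k + 1 < ⌈r * ((n + 1 : ℕ) : NNReal)⌉₊ := by
        rw [Nat.lt_ceil, hr, ← div_eq_mul_inv, ENNReal.div_lt_iff (by simp) (by simp)]
        rw [← ENNReal.coe_natCast, ← ENNReal.coe_natCast, ← ENNReal.coe_mul, ENNReal.coe_lt_coe]
      rw [Finset.mem_filter, this, Finset.mem_range, Finset.mem_range]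
      omega
    have hsum : ∑ k ∈ Finset.range (n + 1), ((n + 1 : ℕ) : ℝ≥0∞)⁻¹ *
        Set.indicator {x | ((k + 1 : ℕ) : ℝ≥0∞) * ((n + 1 : ℕ) : ℝ≥0∞)⁻¹ < f x} 1 x
        = ((⌈r * ((n + 1 : ℕ) : NNReal)⌉₊ - 1 : ℕ) : ℝ≥0∞) * ((n + 1 : ℕ) : ℝ≥0∞)⁻¹ := by
      rw [← Finset.mul_sum, mul_comm]
      congr 1
      have : ∀ k, Set.indicator {x | ((k + 1 : ℕ) : ℝ≥0∞) * ((n + 1 : ℕ) : ℝ≥0∞)⁻¹ < f x}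
          (1 : X → ℝ≥0∞) x
          = if ((k + 1 : ℕ) : ℝ≥0∞) * ((n + 1 : ℕ) : ℝ≥0∞)⁻¹ < f x then 1 else 0 := by
        intro k; simp [Set.indicator]
      simp_rw [this]
      rw [← Finset.sum_filter, hfil]
      simp
    rw [hsum]
    constructor
    · rw [hr, ← div_eq_mul_inv]
      refine ENNReal.div_le_of_le_mul ?_
      rw [← ENNReal.coe_natCast, ← ENNReal.coe_natCast, ← ENNReal.coe_mul, ENNReal.coe_le_coe]
      rcases Nat.eq_zero_or_pos (⌈r * ((n + 1 : ℕ) : NNReal)⌉₊ - 1) with h | h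
      · rw [h]; simp
      · exact (Nat.lt_ceil.mp (by omega)).le
    · rw [← add_one_mul, hr, ← div_eq_mul_inv, ENNReal.le_div_iff_mul_le (by simp) (by simp)]
      have h2 := Nat.le_ceil (r * ((n + 1 : ℕ) : NNReal))
      have h3 : ⌈r * ((n + 1 : ℕ) : NNReal)⌉₊ ≤ (⌈r * ((n + 1 : ℕ) : NNReal)⌉₊ - 1) + 1 := by omega
      have h4 : (⌈r * ((n + 1 : ℕ) : NNReal)⌉₊ : NNReal) ≤
        ((⌈r * ((n + 1 : ℕ) : NNReal)⌉₊ - 1 : ℕ) : NNReal) + 1 := by exact_mod_cast h3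
      have := h2.trans h4
      exact_mod_cast this
  apply le_antisymm
  · refine ENNReal.le_of_forall_pos_le_add fun δ hδ _ => ?_
    obtain ⟨n, hn⟩ := ENNReal.exists_inv_nat_lt (ENNReal.coe_pos.mpr hδ).ne'
    have hn' : ((n + 1 : ℕ) : ℝ≥0∞)⁻¹ ≤ δ :=
      le_trans (ENNReal.inv_le_inv.mpr (by exact_mod_cast Nat.le_succ n)) hn.le
    calc ∫⁻ x, f x ∂μ ≤ _ := lintegral_mono fun x => (hpt n x).2
      _ = _ := lintegral_add_right _ measurable_const
      _ ≤ _ := by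
        rw [← hint n]
        refine add_le_add (le_iSup (fun n : ℕ => ∑ k ∈ Finset.range (n + 1),
          ((n + 1 : ℕ) : ℝ≥0∞)⁻¹ *
          μ {x | ((k + 1 : ℕ) : ℝ≥0∞) * ((n + 1 : ℕ) : ℝ≥0∞)⁻¹ < f x}) n) ?_
        simpa using hn'
  · refine iSup_le fun n => ?_
    rw [hint n]
    exact lintegral_mono fun x => (hpt n x).1

lemma lowerSemicontinuous_lintegral (k : ContKernel X Y) (f : Y → ℝ≥0∞)
    (hf : LowerSemicontinuous f) (h1 : ∀ x, f x ≤ 1) :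
    LowerSemicontinuous fun x => ∫⁻ y, f y ∂(k.kernel x) := by
  simp_rw [fun x => lintegral_eq_iSup_levels (k.kernel x) f hf h1]
  refine lowerSemicontinuous_iSup fun n => lowerSemicontinuous_sum fun j _ => ?_
  have := k.lsc {y | ((j + 1 : ℕ) : ℝ≥0∞) * ((n + 1 : ℕ) : ℝ≥0∞)⁻¹ < f y}
    (hf.isOpen_preimage _)
  exact (ENNReal.continuous_const_mul (by simp)).comp_lowerSemicontinuous this
    fun a b hab => mul_le_mul_right hab _

lemma IsTauSmooth.lintegral_iSup {μ : Measure X} [IsProbabilityMeasure μ] (hμ : IsTauSmooth μ)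
    {ι : Type*} (f : ι → X → ℝ≥0∞)
    (hf : ∀ i, LowerSemicontinuous (f i)) (h1 : ∀ i x, f i x ≤ 1) (hd : Directed (· ≤ ·) f) :
    ∫⁻ x, ⨆ i, f i x ∂μ = ⨆ i, ∫⁻ x, f i x ∂μ := by
  rw [lintegral_eq_iSup_levels μ _ (lowerSemicontinuous_iSup hf) (fun x => iSup_le fun i => h1 i x)]
  simp_rw [fun i => lintegral_eq_iSup_levels μ (f i) (hf i) (h1 i)]
  rw [iSup_comm]
  refine iSup_congr fun n => ?_
  have key : ∀ t : ℝ≥0∞, μ {x | t < ⨆ i, f i x} = ⨆ i, μ {x | t < f i x} := by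
    intro t
    have : {x | t < ⨆ i, f i x} = ⋃₀ (Set.range fun i => {x | t < f i x}) := by
      ext x; simp [lt_iSup_iff]
    rw [this, hμ, iSup_range]
    · rintro _ ⟨i, rfl⟩; exact (hf i).isOpen_preimage t
    · rintro _ ⟨i, rfl⟩ _ ⟨j, rfl⟩
      obtain ⟨l, h1, h2⟩ := hd i j
      exact ⟨_, ⟨l, rfl⟩, fun x hx => lt_of_lt_of_le hx (h1 x), fun x hx => lt_of_lt_of_le hx (h2 x)⟩
  simp_rw [key, ENNReal.mul_iSup]
  refine ENNReal.finsetSum_iSup fun i j => ?_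
  obtain ⟨l, h1, h2⟩ := hd i j
  refine ⟨l, fun a => ⟨?_, ?_⟩⟩
  · gcongr with x; exact h1 x
  · gcongr with x; exact h2 x

/-- The Dirac kernel `x ↦ δ_{f x}` of a continuous map. -/
noncomputable def ContKernel.dirac (f : X → Y) (hf : Continuous f) : ContKernel X Y :=
  .ofFun (fun x => Measure.dirac (f x)) (fun _ => inferInstance) (fun _ => isTauSmooth_dirac _)
    fun U hU => by
      simp_rw [fun x => Measure.dirac_apply' (f x) hU.borelMeasurableSet]
      exact (hU.lowerSemicontinuous_indicator zero_le_one).comp hf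

/-- Composition of kernels: `(l ∘ k)(A|x) = ∫ l(A|y) k(dy|x)`. -/
noncomputable def ContKernel.comp (l : ContKernel Y Z) (k : ContKernel X Y) : ContKernel X Z where
  kernel := l.kernel ∘ₖ k.kernel
  isMarkov := inferInstance
  tauSmooth x := by
    intro D hD hdir
    rw [Kernel.comp_apply' _ _ _ (isOpen_sUnion hD).borelMeasurableSet]
    simp_rw [fun y => l.tauSmooth y D hD hdir, iSup_subtype']
    rw [(k.tauSmooth x).lintegral_iSup]
    · refine iSup_congr fun U => ?_
      rw [Kernel.comp_apply' _ _ _ (hD U U.2).borelMeasurableSet]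
    · exact fun U => l.lsc U (hD U U.2)
    · exact fun U y => prob_le_one
    · rintro ⟨U, hU⟩ ⟨V, hV⟩
      obtain ⟨T, hT, h1, h2⟩ := hdir U hU V hV
      exact ⟨⟨T, hT⟩, fun y => measure_mono h1, fun y => measure_mono h2⟩
  lsc U hU := by
    simp_rw [fun x => Kernel.comp_apply' l.kernel k.kernel x hU.borelMeasurableSet]
    exact lowerSemicontinuous_lintegral k _ (l.lsc U hU) fun _ => prob_le_one

/-- The kernel `id ⊗ k`: given `(w, x)`, keep `w` and sample from `k` at `x`. -/
noncomputable def ContKernel.whiskerLeft (W : Type*) [TopologicalSpace W] (k : ContKernel X Y) :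
    ContKernel (W × X) (W × Y) :=
  .ofFun (fun p => (k.kernel p.2).map fun y => (p.1, y))
    (fun p => Measure.isProbabilityMeasure_map
      (borelMeasurable (Continuous.prodMk_right p.1)).aemeasurable)
    (fun p => (k.tauSmooth p.2).map (Continuous.prodMk_right p.1))
    (by
      intro U hU
      have hm : ∀ w : W, Measurable fun y : Y => (w, y) := fun w =>
        borelMeasurable (Continuous.prodMk_right w)
      simp_rw [fun p : W × X => Measure.map_apply (μ := k.kernel p.2) (hm p.1)
        hU.borelMeasurableSet]
      rintro ⟨w, x⟩ t ht
      let D : Set (Set Y) := {B | IsOpen B ∧ ∃ A : Set W, IsOpen A ∧ w ∈ A ∧ A ×ˢ B ⊆ U}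
      have hD : ∀ B ∈ D, IsOpen B := fun B hB => hB.1
      have hdir : DirectedOn (· ⊆ ·) D := by
        rintro B ⟨hB, A, hA, hw, hs⟩ B' ⟨hB', A', hA', hw', hs'⟩
        refine ⟨B ∪ B', ⟨hB.union hB', A ∩ A', hA.inter hA', ⟨hw, hw'⟩, ?_⟩,
          Set.subset_union_left, Set.subset_union_right⟩
        rintro ⟨a, b⟩ ⟨⟨ha, ha'⟩, hb | hb⟩
        · exact hs ⟨ha, hb⟩
        · exact hs' ⟨ha', hb⟩
      have hun : (fun y : Y => (w, y)) ⁻¹' U = ⋃₀ D := by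
        ext y
        constructor
        · intro hy
          obtain ⟨A, B, hA, hB, hw, hyB, hs⟩ := isOpen_prod_iff.mp hU w y hy
          exact ⟨B, ⟨hB, A, hA, hw, hs⟩, hyB⟩
        · rintro ⟨B, ⟨_, A, _, hw, hs⟩, hy⟩
          exact hs ⟨hw, hy⟩
      have ht' : t < k.kernel x (⋃₀ D) := by rw [← hun]; exact ht
      rw [k.tauSmooth x D hD hdir, lt_iSup_iff] at ht'
      obtain ⟨B, hB⟩ := ht'
      rw [lt_iSup_iff] at hB
      obtain ⟨⟨hBo, A, hA, hw, hs⟩, hB⟩ := hB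
      have e1 : ∀ᶠ p : W × X in nhds (w, x), p.1 ∈ A :=
        continuous_fst.continuousAt.eventually (hA.mem_nhds hw)
      have e2 : ∀ᶠ p : W × X in nhds (w, x), t < k.kernel p.2 B :=
        (continuous_snd.continuousAt (x := (w, x))).eventually
          (p := fun a => t < k.kernel a B) (k.lsc B hBo x t hB)
      filter_upwards [e1, e2] with p h1 h2
      exact h2.trans_le (measure_mono fun y hy => hs ⟨h1, hy⟩))

/-- The kernel `k ⊗ id`: given `(x, w)`, sample from `k` at `x` and keep `w`. -/
noncomputable def ContKernel.whiskerRight (k : ContKernel X Y) (W : Type*) [TopologicalSpace W] :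
    ContKernel (X × W) (Y × W) :=
  .ofFun (fun p => (k.kernel p.1).map fun y => (y, p.2))
    (fun p => Measure.isProbabilityMeasure_map
      (borelMeasurable (Continuous.prodMk_left p.2)).aemeasurable)
    (fun p => (k.tauSmooth p.1).map (Continuous.prodMk_left p.2))
    (by
      intro U hU
      have hU' : IsOpen (Prod.swap ⁻¹' U : Set (W × Y)) := hU.preimage continuous_swap
      have h := ((k.whiskerLeft W).lsc _ hU').comp (continuous_swap (X := X) (Y := W))
      convert h using 2 with p
      change _ = ((k.kernel p.1).map fun y => (p.2, y)) _
      rw [Measure.map_apply (borelMeasurable (Continuous.prodMk_left p.2)) hU.borelMeasurableSet,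
        Measure.map_apply (borelMeasurable (Continuous.prodMk_right p.2)) hU'.borelMeasurableSet]
      rfl)

namespace ContKernel

lemma comp_apply_open (l : ContKernel Y Z) (k : ContKernel X Y) (x : X) {A : Set Z}
    (hA : MeasurableSet A) : (l.comp k).kernel x A = ∫⁻ y, l.kernel y A ∂(k.kernel x) :=
  Kernel.comp_apply' _ _ _ hA

lemma dirac_apply (f : X → Y) (hf : Continuous f) (x : X) :
    (dirac f hf).kernel x = Measure.dirac (f x) := rfl

lemma whiskerLeft_apply (k : ContKernel X Y) (p : W × X) :
    (k.whiskerLeft W).kernel p = (k.kernel p.2).map fun y => (p.1, y) := rfl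

lemma whiskerRight_apply (k : ContKernel X Y) (p : X × W) :
    (k.whiskerRight W).kernel p = (k.kernel p.1).map fun y => (y, p.2) := rfl

lemma kernel_measurable_coe (k : ContKernel X Y) {A : Set Y} (hA : MeasurableSet A) :
    Measurable fun x => k.kernel x A := k.kernel.measurable_coe hA

lemma comp_dirac (k : ContKernel Y Z) (f : X → Y) (hf : Continuous f) (x : X) :
    (k.comp (dirac f hf)).kernel x = k.kernel (f x) := by
  ext A hA
  rw [comp_apply_open _ _ _ hA, dirac_apply, lintegral_dirac' _ (k.kernel_measurable_coe hA)]

lemma dirac_comp (k : ContKernel X Y) (f : Y → Z) (hf : Continuous f) (x : X) :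
    ((dirac f hf).comp k).kernel x = (k.kernel x).map f := by
  ext A hA
  have hm := borelMeasurable hf
  rw [comp_apply_open _ _ _ hA, Measure.map_apply hm hA, ← lintegral_indicator_one (hm hA)]
  refine lintegral_congr fun y => ?_
  rw [dirac_apply, Measure.dirac_apply' _ hA]
  rfl

lemma dirac_comp_dirac (f : X → Y) (hf : Continuous f) (g : Y → Z) (hg : Continuous g) :
    (dirac g hg).comp (dirac f hf) = dirac (g ∘ f) (hg.comp hf) :=
  ext_apply fun x => by rw [comp_dirac]; rfl

lemma whiskerLeft_dirac (f : X → Y) (hf : Continuous f) :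
    (dirac f hf).whiskerLeft W = dirac (Prod.map id f) (continuous_id.prodMap hf) :=
  ext_apply fun p => by
    rw [whiskerLeft_apply, dirac_apply, dirac_apply,
      Measure.map_dirac' (borelMeasurable (Continuous.prodMk_right p.1))]
    rfl

lemma whiskerRight_dirac (f : X → Y) (hf : Continuous f) :
    (dirac f hf).whiskerRight W = dirac (Prod.map f id) (hf.prodMap continuous_id) :=
  ext_apply fun p => by
    rw [whiskerRight_apply, dirac_apply, dirac_apply,
      Measure.map_dirac' (borelMeasurable (Continuous.prodMk_left p.2))]
    rfl

lemma comp_assoc' {V : Type*} [TopologicalSpace V] (m : ContKernel Z V) (l : ContKernel Y Z)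
    (k : ContKernel X Y) : (m.comp l).comp k = m.comp (l.comp k) :=
  ext_apply fun x => by
    change ((m.kernel ∘ₖ l.kernel) ∘ₖ k.kernel) x = (m.kernel ∘ₖ (l.kernel ∘ₖ k.kernel)) x
    rw [Kernel.comp_assoc]

lemma whiskerLeft_comp (l : ContKernel Y Z) (k : ContKernel X Y) :
    (l.comp k).whiskerLeft W = (l.whiskerLeft W).comp (k.whiskerLeft W) :=
  ext_apply fun p => by
    ext A hA
    have h1 := borelMeasurable (Continuous.prodMk_right (Y := Z) p.1)
    have h2 := borelMeasurable (Continuous.prodMk_right (Y := Y) p.1)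
    rw [comp_apply_open _ _ _ hA, whiskerLeft_apply, whiskerLeft_apply,
      lintegral_map (kernel_measurable_coe _ hA) h2, Measure.map_apply h1 hA,
      comp_apply_open _ _ _ (h1 hA)]
    refine lintegral_congr fun y => ?_
    rw [whiskerLeft_apply, Measure.map_apply h1 hA]

lemma whiskerRight_comp (l : ContKernel Y Z) (k : ContKernel X Y) :
    (l.comp k).whiskerRight W = (l.whiskerRight W).comp (k.whiskerRight W) :=
  ext_apply fun p => by
    ext A hA
    have h1 := borelMeasurable (Continuous.prodMk_left (X := Z) p.2)
    have h2 := borelMeasurable (Continuous.prodMk_left (X := Y) p.2)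
    rw [comp_apply_open _ _ _ hA, whiskerRight_apply, whiskerRight_apply,
      lintegral_map (kernel_measurable_coe _ hA) h2, Measure.map_apply h1 hA,
      comp_apply_open _ _ _ (h1 hA)]
    refine lintegral_congr fun y => ?_
    rw [whiskerRight_apply, Measure.map_apply h1 hA]

/-- τ-smooth probability measures on a product are determined on open rectangles. -/
lemma _root_.IsTauSmooth.ext_prod {μ ν : Measure (X × Y)} [IsProbabilityMeasure μ]
    [IsProbabilityMeasure ν] (hμ : IsTauSmooth μ) (hν : IsTauSmooth ν)
    (h : ∀ (A : Set X) (B : Set Y), IsOpen A → IsOpen B → μ (A ×ˢ B) = ν (A ×ˢ B)) : μ = ν := by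
  let R : Set (Set (X × Y)) := {S | ∃ A B, IsOpen A ∧ IsOpen B ∧ A ×ˢ B = S}
  have hpi : IsPiSystem R := by
    rintro _ ⟨A, B, hA, hB, rfl⟩ _ ⟨A', B', hA', hB', rfl⟩ _
    exact ⟨A ∩ A', B ∩ B', hA.inter hA', hB.inter hB', Set.prod_inter_prod.symm⟩
  have hle : MeasurableSpace.generateFrom R ≤ borel (X × Y) := by
    refine MeasurableSpace.generateFrom_le ?_
    rintro _ ⟨A, B, hA, hB, rfl⟩
    exact (hA.prod hB).borelMeasurableSet
  have heq : ∀ S, MeasurableSet[MeasurableSpace.generateFrom R] S → μ S = ν S := fun S hS =>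
    ext_on_measurableSpace_of_generate_finite (borel (X × Y)) R
      (by rintro _ ⟨A, B, hA, hB, rfl⟩; exact h A B hA hB) hle rfl hpi (by simp) hS
  refine measure_eq_of_open fun U hU => ?_
  let D : Set (Set (X × Y)) :=
    {S | IsOpen S ∧ S ⊆ U ∧ MeasurableSet[MeasurableSpace.generateFrom R] S}
  have hD : ∀ S ∈ D, IsOpen S := fun S hS => hS.1
  have hdir : DirectedOn (· ⊆ ·) D := fun S hS T hT =>
    ⟨S ∪ T, ⟨hS.1.union hT.1, Set.union_subset hS.2.1 hT.2.1, hS.2.2.union hT.2.2⟩,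
      Set.subset_union_left, Set.subset_union_right⟩
  have hun : U = ⋃₀ D := by
    ext ⟨x, y⟩
    constructor
    · intro hy
      obtain ⟨A, B, hA, hB, hx, hyB, hs⟩ := isOpen_prod_iff.mp hU x y hy
      exact ⟨A ×ˢ B, ⟨hA.prod hB, hs,
        MeasurableSpace.measurableSet_generateFrom ⟨A, B, hA, hB, rfl⟩⟩, hx, hyB⟩
    · rintro ⟨S, hS, hy⟩
      exact hS.2.1 hy
  rw [hun, hμ D hD hdir, hν D hD hdir]
  exact iSup_congr fun S => iSup_congr fun hS => heq S hS.2.2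

/-- Sampling independently from `k` and `l` gives the product measure on rectangles. -/
lemma whisker_rect {V : Type*} [TopologicalSpace V] (k : ContKernel X Y) (l : ContKernel V Z)
    (p : X × V) {A : Set Y} {B : Set Z} (hA : MeasurableSet A)
    (hAB : MeasurableSet (A ×ˢ B)) :
    ((l.whiskerLeft Y).comp (k.whiskerRight V)).kernel p (A ×ˢ B)
      = k.kernel p.1 A * l.kernel p.2 B := by
  have h1 := borelMeasurable (Continuous.prodMk_left (X := Y) p.2)
  rw [comp_apply_open _ _ _ hAB, whiskerRight_apply,
    lintegral_map (kernel_measurable_coe _ hAB) h1]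
  have : ∀ y, (l.whiskerLeft Y).kernel (y, p.2) (A ×ˢ B)
      = A.indicator (fun _ => l.kernel p.2 B) y := by
    intro y
    rw [whiskerLeft_apply, Measure.map_apply (borelMeasurable (Continuous.prodMk_right y)) hAB]
    by_cases hy : y ∈ A <;> simp [hy]
  simp_rw [this]
  rw [lintegral_indicator_const hA, mul_comm]

lemma whisker_rect' {V : Type*} [TopologicalSpace V] (k : ContKernel X Y) (l : ContKernel V Z)
    (p : X × V) {A : Set Y} {B : Set Z} (hB : MeasurableSet B)
    (hAB : MeasurableSet (A ×ˢ B)) :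
    ((k.whiskerRight Z).comp (l.whiskerLeft X)).kernel p (A ×ˢ B)
      = k.kernel p.1 A * l.kernel p.2 B := by
  have h1 := borelMeasurable (Continuous.prodMk_right (Y := Z) p.1)
  rw [comp_apply_open _ _ _ hAB, whiskerLeft_apply,
    lintegral_map (kernel_measurable_coe _ hAB) h1]
  have : ∀ z, (k.whiskerRight Z).kernel (p.1, z) (A ×ˢ B)
      = B.indicator (fun _ => k.kernel p.1 A) z := by
    intro z
    rw [whiskerRight_apply, Measure.map_apply (borelMeasurable (Continuous.prodMk_left z)) hAB]
    by_cases hz : z ∈ B <;> simp [hz]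
  simp_rw [this]
  rw [lintegral_indicator_const hB]

lemma whisker_exchange {V : Type*} [TopologicalSpace V] (k : ContKernel X Y)
    (l : ContKernel V Z) :
    (k.whiskerRight Z).comp (l.whiskerLeft X) = (l.whiskerLeft Y).comp (k.whiskerRight V) :=
  ext_apply fun p => IsTauSmooth.ext_prod (tauSmooth _ p) (tauSmooth _ p) fun A B hA hB => by
    rw [whisker_rect k l p hA.borelMeasurableSet
      (hA.prod hB).borelMeasurableSet,
      whisker_rect' k l p hB.borelMeasurableSet (hA.prod hB).borelMeasurableSet]

end ContKernel

end Borel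

/-! ### The Markov category `TopStoch` -/

/-- Objects of `TopStoch`: topological spaces. -/
structure TopStoch : Type (u + 1) where
  of ::
  carrier : Type u
  [str : TopologicalSpace carrier]

attribute [instance] TopStoch.str

namespace TopStoch

noncomputable section

open ContKernel

instance : LargeCategory TopStoch.{u} where
  Hom X Y := ContKernel X.carrier Y.carrier
  id X := ContKernel.dirac id continuous_id
  comp k l := ContKernel.comp l k
  id_comp k := ext_apply fun x => comp_dirac _ _ _ x
  comp_id k := ext_apply fun x => by rw [dirac_comp]; exact Measure.map_id
  assoc k l m := (comp_assoc' m l k).symm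

/-- The morphism `x ↦ δ_{f x}` given by a continuous function. -/
def diracHom {X Y : TopStoch.{u}} (f : X.carrier → Y.carrier) (hf : Continuous f) : X ⟶ Y :=
  ContKernel.dirac f hf

/-- The isomorphism given by a homeomorphism. -/
def diracIso {X Y : TopStoch.{u}} (f : X.carrier ≃ₜ Y.carrier) : X ≅ Y where
  hom := diracHom f f.continuous
  inv := diracHom f.symm f.symm.continuous
  hom_inv_id := (dirac_comp_dirac _ _ _ _).trans (by congr 1; ext x; simp)
  inv_hom_id := (dirac_comp_dirac _ _ _ _).trans (by congr 1; ext x; simp)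

instance : MonoidalCategoryStruct TopStoch.{u} where
  tensorObj X Y := of (X.carrier × Y.carrier)
  whiskerLeft X _ _ k := ContKernel.whiskerLeft X.carrier k
  whiskerRight k Y := ContKernel.whiskerRight k Y.carrier
  tensorUnit := of PUnit
  associator X Y Z := diracIso (Homeomorph.prodAssoc X.carrier Y.carrier Z.carrier)
  leftUnitor X := diracIso (Homeomorph.punitProd X.carrier)
  rightUnitor X := diracIso (Homeomorph.prodPUnit X.carrier)

section aux

variable {X Y Z W X' Y' Z' : TopStoch.{u}}

lemma hom_ext_apply {k l : X ⟶ Y} (h : ∀ x, ContKernel.kernel k x = ContKernel.kernel l x) :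
    k = l := ext_apply h

lemma id_eq (X : TopStoch.{u}) : 𝟙 X = diracHom id continuous_id := rfl

lemma diracHom_comp (f : X.carrier → Y.carrier) (hf : Continuous f)
    (g : Y.carrier → Z.carrier) (hg : Continuous g) :
    diracHom f hf ≫ diracHom g hg = diracHom (g ∘ f) (hg.comp hf) := dirac_comp_dirac _ _ _ _

lemma whiskerLeft_diracHom (W : TopStoch.{u}) (f : X.carrier → Y.carrier) (hf : Continuous f) :
    W ◁ diracHom f hf = diracHom (X := W ⊗ X) (Y := W ⊗ Y) (Prod.map id f)
      (continuous_id.prodMap hf) := whiskerLeft_dirac _ _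

lemma whiskerRight_diracHom (W : TopStoch.{u}) (f : X.carrier → Y.carrier) (hf : Continuous f) :
    diracHom f hf ▷ W = diracHom (X := X ⊗ W) (Y := Y ⊗ W) (Prod.map f id)
      (hf.prodMap continuous_id) := whiskerRight_dirac _ _

lemma wl_comp (W : TopStoch.{u}) (k : X ⟶ Y) (l : Y ⟶ Z) : W ◁ (k ≫ l) = W ◁ k ≫ W ◁ l :=
  ContKernel.whiskerLeft_comp _ _

lemma wr_comp (W : TopStoch.{u}) (k : X ⟶ Y) (l : Y ⟶ Z) : (k ≫ l) ▷ W = k ▷ W ≫ l ▷ W :=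
  ContKernel.whiskerRight_comp _ _

lemma w_exchange (k : X ⟶ Y) (l : W ⟶ Z) : X ◁ l ≫ k ▷ Z = k ▷ W ≫ Y ◁ l :=
  ContKernel.whisker_exchange _ _

lemma tensorHom_eq (k : X ⟶ Y) (l : W ⟶ Z) : k ⊗ₘ l = k ▷ W ≫ Y ◁ l := rfl

lemma comp_diracHom_apply (k : X ⟶ Y) (f : Y.carrier → Z.carrier) (hf : Continuous f)
    (x : X.carrier) :
    ContKernel.kernel (k ≫ diracHom f hf) x
      = @Measure.map _ _ (borel _) (borel _) f (ContKernel.kernel k x) :=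
  dirac_comp _ _ _ _

lemma diracHom_comp_apply (k : Y ⟶ Z) (f : X.carrier → Y.carrier) (hf : Continuous f)
    (x : X.carrier) :
    ContKernel.kernel (diracHom f hf ≫ k) x = ContKernel.kernel k (f x) :=
  comp_dirac _ _ _ _

lemma whiskerLeft_hom_apply (W : TopStoch.{u}) (k : X ⟶ Y) (p : W.carrier × X.carrier) :
    ContKernel.kernel (W ◁ k) p
      = @Measure.map _ _ (borel _) (borel _) (fun y => (p.1, y)) (ContKernel.kernel k p.2) := rfl

lemma whiskerRight_hom_apply (W : TopStoch.{u}) (k : X ⟶ Y) (p : X.carrier × W.carrier) :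
    ContKernel.kernel (k ▷ W) p
      = @Measure.map _ _ (borel _) (borel _) (fun y => (y, p.2)) (ContKernel.kernel k p.1) := rfl

/-- `k ⊗ l` is the product kernel. -/
lemma tensorHom_prod_apply (k : X ⟶ Y) (l : W ⟶ Z) (p : X.carrier × W.carrier)
    {A : Set Y.carrier} {B : Set Z.carrier} (hA : MeasurableSet[borel _] A)
    (hB : MeasurableSet[borel _] B) :
    ContKernel.kernel (k ⊗ₘ l) p (A ×ˢ B)
      = ContKernel.kernel k p.1 A * ContKernel.kernel l p.2 B :=
  whisker_rect k l p hA <| by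
    have h1 := @borelMeasurable (Y.carrier × Z.carrier) _ _ _ _ continuous_fst
    have h2 := @borelMeasurable (Y.carrier × Z.carrier) _ _ _ _ continuous_snd
    exact @MeasurableSet.inter _ (borel _) _ _ (h1 hA) (h2 hB)

lemma map_map_borel {X Y Z : Type*} [TopologicalSpace X] [TopologicalSpace Y] [TopologicalSpace Z]
    (μ : @Measure X (borel X)) {f : X → Y} {g : Y → Z} (hf : Continuous f) (hg : Continuous g) :
    @Measure.map _ _ (borel _) (borel _) g (@Measure.map _ _ (borel _) (borel _) f μ)
      = @Measure.map _ _ (borel _) (borel _) (g ∘ f) μ :=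
  @Measure.map_map _ _ _ (borel _) (borel _) (borel _) _ _ _ (borelMeasurable hg)
    (borelMeasurable hf)

lemma natural_of_map (k : X ⟶ Y) (f : Y.carrier ≃ₜ Z.carrier) (g : X.carrier ≃ₜ W.carrier)
    (l : W ⟶ Z)
    (h : ∀ x, @Measure.map _ _ (borel _) (borel _) f (ContKernel.kernel k x)
      = ContKernel.kernel l (g x)) :
    k ≫ (diracIso f).hom = (diracIso g).hom ≫ l :=
  hom_ext_apply fun x => (comp_diracHom_apply k f f.continuous x).trans
    ((h x).trans (diracHom_comp_apply l g g.continuous x).symm)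

lemma associator_hom_eq (X Y Z : TopStoch.{u}) : (α_ X Y Z).hom
    = diracHom (X := (X ⊗ Y) ⊗ Z) (Y := X ⊗ (Y ⊗ Z))
      (Homeomorph.prodAssoc X.carrier Y.carrier Z.carrier) (Homeomorph.continuous _) := rfl

lemma associator_inv_eq (X Y Z : TopStoch.{u}) : (α_ X Y Z).inv
    = diracHom (X := X ⊗ (Y ⊗ Z)) (Y := (X ⊗ Y) ⊗ Z)
      (Homeomorph.prodAssoc X.carrier Y.carrier Z.carrier).symm (Homeomorph.continuous _) := rfl

lemma leftUnitor_hom_eq (X : TopStoch.{u}) : (λ_ X).hom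
    = diracHom (X := 𝟙_ TopStoch ⊗ X) (Homeomorph.punitProd X.carrier)
      (Homeomorph.continuous _) := rfl

lemma leftUnitor_inv_eq (X : TopStoch.{u}) : (λ_ X).inv
    = diracHom (Y := 𝟙_ TopStoch ⊗ X) (Homeomorph.punitProd X.carrier).symm
      (Homeomorph.continuous _) := rfl

lemma rightUnitor_hom_eq (X : TopStoch.{u}) : (ρ_ X).hom
    = diracHom (X := X ⊗ 𝟙_ TopStoch) (Homeomorph.prodPUnit X.carrier)
      (Homeomorph.continuous _) := rfl

lemma rightUnitor_inv_eq (X : TopStoch.{u}) : (ρ_ X).inv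
    = diracHom (Y := X ⊗ 𝟙_ TopStoch) (Homeomorph.prodPUnit X.carrier).symm
      (Homeomorph.continuous _) := rfl

lemma associator_nat_left (f : X ⟶ Y) (Z W : TopStoch.{u}) :
    (f ▷ Z) ▷ W ≫ (α_ Y Z W).hom = (α_ X Z W).hom ≫ f ▷ (Z ⊗ W) :=
  natural_of_map _ _ _ _ fun _ =>
    (map_map_borel _ (Continuous.prodMk_left _) (Homeomorph.continuous _)).trans
      (map_map_borel _ (Continuous.prodMk_left _)
        ((Homeomorph.continuous _).comp (Continuous.prodMk_left _)))

lemma associator_nat_middle (f : X ⟶ Y) (Z W : TopStoch.{u}) :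
    (Z ◁ f) ▷ W ≫ (α_ Z Y W).hom = (α_ Z X W).hom ≫ Z ◁ (f ▷ W) :=
  natural_of_map _ _ _ _ fun _ =>
    (map_map_borel _ (Continuous.prodMk_left _) (Homeomorph.continuous _)).trans
      ((map_map_borel _ (Continuous.prodMk_right _)
        ((Homeomorph.continuous _).comp (Continuous.prodMk_left _))).trans
      (map_map_borel _ (Continuous.prodMk_left _) (Continuous.prodMk_right _)).symm)

lemma associator_nat_right (f : X ⟶ Y) (Z W : TopStoch.{u}) :
    (Z ⊗ W) ◁ f ≫ (α_ Z W Y).hom = (α_ Z W X).hom ≫ Z ◁ (W ◁ f) :=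
  natural_of_map _ _ _ _ fun p =>
    (map_map_borel _ (Continuous.prodMk_right _) (Homeomorph.continuous _)).trans
      (map_map_borel (ContKernel.kernel f p.2) (Continuous.prodMk_right p.1.2)
        (Continuous.prodMk_right p.1.1)).symm

end aux

instance : MonoidalCategory TopStoch.{u} where
  tensorHom_def _ _ := rfl
  id_tensorHom_id X Y := by
    rw [tensorHom_eq, id_eq, id_eq, whiskerLeft_diracHom, whiskerRight_diracHom, diracHom_comp]
    rfl
  tensorHom_comp_tensorHom f₁ f₂ g₁ g₂ := by
    simp only [tensorHom_eq, wl_comp, wr_comp, Category.assoc]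
    rw [← Category.assoc (_ ◁ f₂), w_exchange, Category.assoc]
  whiskerLeft_id X Y := by
    rw [id_eq, whiskerLeft_diracHom]; rfl
  id_whiskerRight X Y := by
    rw [id_eq, whiskerRight_diracHom]; rfl
  associator_naturality {X₁ X₂ X₃ Y₁ Y₂ Y₃} f₁ f₂ f₃ := by
    simp only [tensorHom_eq, wl_comp, wr_comp, Category.assoc]
    rw [associator_nat_right, ← Category.assoc (_ ▷ _) (α_ Y₁ Y₂ X₃).hom, associator_nat_middle,
      Category.assoc, ← Category.assoc (_ ▷ _) (α_ Y₁ X₂ X₃).hom, associator_nat_left,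
      Category.assoc]
  leftUnitor_naturality f := natural_of_map _ _ _ _ fun _ =>
    (map_map_borel _ (Continuous.prodMk_right _) (Homeomorph.continuous _)).trans
      (@Measure.map_id _ (borel _) _)
  rightUnitor_naturality f := natural_of_map _ _ _ _ fun _ =>
    (map_map_borel _ (Continuous.prodMk_left _) (Homeomorph.continuous _)).trans
      (@Measure.map_id _ (borel _) _)
  pentagon W X Y Z := by
    simp only [associator_hom_eq, whiskerLeft_diracHom, whiskerRight_diracHom, diracHom_comp]
    rfl
  triangle X Y := by
    simp only [associator_hom_eq, leftUnitor_hom_eq, rightUnitor_hom_eq, whiskerLeft_diracHom,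
      whiskerRight_diracHom, diracHom_comp]
    rfl

/-- The swap `(x, y) ↦ δ_{(y, x)}`. -/
def swapIso (X Y : TopStoch.{u}) : X ⊗ Y ≅ Y ⊗ X :=
  diracIso (X := X ⊗ Y) (Y := Y ⊗ X) (Homeomorph.prodComm X.carrier Y.carrier)

lemma swapIso_hom_eq (X Y : TopStoch.{u}) : (swapIso X Y).hom
    = diracHom (X := X ⊗ Y) (Y := Y ⊗ X) Prod.swap continuous_swap := rfl

instance : SymmetricCategory TopStoch.{u} where
  braiding := swapIso
  braiding_naturality_right X Y Z f := natural_of_map _ _ _ _ fun _ =>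
    map_map_borel _ (Continuous.prodMk_right _) (Homeomorph.continuous _)
  braiding_naturality_left f Z := natural_of_map _ _ _ _ fun _ =>
    map_map_borel _ (Continuous.prodMk_left _) (Homeomorph.continuous _)
  hexagon_forward X Y Z := by
    simp only [associator_hom_eq, swapIso_hom_eq, whiskerLeft_diracHom, whiskerRight_diracHom,
      diracHom_comp]
    rfl
  hexagon_reverse X Y Z := by
    simp only [associator_inv_eq, swapIso_hom_eq, whiskerLeft_diracHom, whiskerRight_diracHom,
      diracHom_comp]
    rfl
  symmetry X Y := by
    simp only [swapIso_hom_eq, diracHom_comp]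
    rfl

lemma braiding_hom_eq (X Y : TopStoch.{u}) : (β_ X Y).hom
    = diracHom (X := X ⊗ Y) (Y := Y ⊗ X) Prod.swap continuous_swap := rfl

/-- Copying: `x ↦ δ_{(x, x)}`. -/
def copy (X : TopStoch.{u}) : X ⟶ X ⊗ X :=
  diracHom (Y := X ⊗ X) (fun x => (x, x)) (continuous_id.prodMk continuous_id)

/-- Discarding: the only kernel to the one-point space. -/
def discard (X : TopStoch.{u}) : X ⟶ 𝟙_ TopStoch.{u} :=
  diracHom (Y := 𝟙_ TopStoch) (fun _ => PUnit.unit) continuous_const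

instance (X : TopStoch.{u}) : ComonObj X where
  counit := discard X
  comul := copy X
  counit_comul := by
    simp only [copy, discard, leftUnitor_inv_eq, whiskerRight_diracHom, diracHom_comp]
    rfl
  comul_counit := by
    simp only [copy, discard, rightUnitor_inv_eq, whiskerLeft_diracHom, diracHom_comp]
    rfl
  comul_assoc := by
    simp only [copy, associator_hom_eq, whiskerLeft_diracHom, whiskerRight_diracHom, diracHom_comp]
    rfl

lemma comul_eq (X : TopStoch.{u}) : Δ[X] = diracHom (Y := X ⊗ X) (fun x => (x, x))
    (continuous_id.prodMk continuous_id) := rfl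

lemma counit_eq (X : TopStoch.{u}) : ε[X] = diracHom (Y := 𝟙_ TopStoch) (fun _ => PUnit.unit)
    continuous_const := rfl

instance : MarkovCategory TopStoch.{u} where
  isCommComonObj X := ⟨by
    simp only [comul_eq, braiding_hom_eq, diracHom_comp]
    rfl⟩
  copy_tensor X Y := by
    simp only [comul_eq, MonoidalCategory.tensorμ, braiding_hom_eq, associator_hom_eq,
      associator_inv_eq, MonoidalCategory.tensorHom_def, whiskerLeft_diracHom,
      whiskerRight_diracHom, diracHom_comp]
    rfl
  discard_tensor X Y := by
    simp only [counit_eq, leftUnitor_hom_eq, MonoidalCategory.tensorHom_def, whiskerLeft_diracHom,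
      whiskerRight_diracHom, diracHom_comp]
    rfl
  copy_unit := rfl
  discard_unit := rfl
  discard_natural {X Y} f := by
    refine hom_ext_apply fun x => ?_
    have hp : IsProbabilityMeasure (ContKernel.kernel f x) := (ContKernel.isMarkov f).1 x
    refine (comp_diracHom_apply f _ continuous_const x).trans ?_
    refine (@Measure.map_const _ _ (borel _) (borel _) _ _).trans ?_
    rw [measure_univ, one_smul]
    rfl

/-! ### The invariant topology and the orbit map -/

/-- An open set `U` is invariant under `act` if `act(U|g, x) = 1` for all `g` and all `x ∈ U`. -/
def IsInvariantOpen {G X : TopStoch.{u}} (act : G ⊗ X ⟶ X) (U : Set X.carrier) : Prop :=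
  IsOpen U ∧ ∀ (g : G.carrier), ∀ x ∈ U, ContKernel.kernel act (g, x) U = 1

/-- The topology on `X` whose open sets are the invariant open sets. -/
@[reducible] def invariantTopology {G X : TopStoch.{u}} (act : G ⊗ X ⟶ X) : TopologicalSpace X.carrier where
  IsOpen := IsInvariantOpen act
  isOpen_univ := ⟨isOpen_univ, fun g x _ => by
    have : IsProbabilityMeasure (ContKernel.kernel act (g, x)) := (ContKernel.isMarkov act).1 _
    exact measure_univ⟩
  isOpen_inter U V hU hV := ⟨hU.1.inter hV.1, fun g x hx => by
    have : IsProbabilityMeasure (ContKernel.kernel act (g, x)) := (ContKernel.isMarkov act).1 _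
    have hU' := IsOpen.borelMeasurableSet hU.1
    have hV' := IsOpen.borelMeasurableSet hV.1
    have h1 := (mem_ae_iff_prob_eq_one hU').mpr (hU.2 g x hx.1)
    have h2 := (mem_ae_iff_prob_eq_one hV').mpr (hV.2 g x hx.2)
    exact (mem_ae_iff_prob_eq_one (hU'.inter hV')).mp (Filter.inter_mem h1 h2)⟩
  isOpen_sUnion D hD := ⟨isOpen_sUnion fun U hU => (hD U hU).1, fun g x hx => by
    have : IsProbabilityMeasure (ContKernel.kernel act (g, x)) := (ContKernel.isMarkov act).1 _
    obtain ⟨U, hU, hxU⟩ := hx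
    refine le_antisymm prob_le_one ?_
    rw [← (hD U hU).2 g x hxU]
    exact measure_mono (Set.subset_sUnion_of_mem hU)⟩

/-- `X/G`: the points of `X` with the invariant topology. -/
def quotient {G X : TopStoch.{u}} (act : G ⊗ X ⟶ X) : TopStoch.{u} :=
  @of X.carrier (invariantTopology act)

/-- The kernel `q : X ⟶ X/G`, `q(A|x) = δ_x(A)`. -/
def quotientMap {G X : TopStoch.{u}} (act : G ⊗ X ⟶ X) : X ⟶ quotient act :=
  diracHom (Y := quotient act) (fun x => x) ⟨fun _ hU => And.left hU⟩

end

end TopStoch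

namespace TopStoch

/-! ### Evaluating composite kernels -/

section Borel

attribute [local instance 2000] borel

variable {G X Y Z W : TopStoch.{u}}

/-! A deterministic kernel need not be given by a map of points, so "`g` moves `x` into `U`" is read
as a statement about the number `act(U|g,x)`. Determinism forces this number to be `0` or `1`
(`kernel_eq_zero_or_one`). The group and action axioms become integral identities; the decisive one,
`lintegral_act_inv_act`, says that acting with `g` and then with its inverse is the Dirac measure at
`x`. Hence an invariant open set also contains every point that is moved into it, so `act(U|g,x)` is
the indicator of `U` at `x`. This is the equation saying that `quotientMap act` coequalises `act`
and the trivial action.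

For the universal property, let `k` coequalise the two. Each function `x ↦ k(U|x)` with `U` open is
then lower semicontinuous and equal to its own average under every `act(·|g,x)`. By the zero-one law
its superlevel sets are invariant, so the same family of measures is a continuous kernel on `X/G`.
Uniqueness is automatic, because `quotientMap act` is the identity on points.

Preservation by `(-) ⊗ Y` needs openness in the product topology on `X/G × Y`, which is more than
invariance in the first variable. It comes from saturation: an open set has an invariant open
saturation (`isInvariantOpen_saturation`), so an open rectangle `A × B` inside a superlevel set can
be enlarged to `saturation act A × B` without leaving it (`lowerSemicontinuous_quotient_prod`). -/

lemma measurable_kernel_apply (k : X ⟶ Y) {A : Set Y.carrier} (hA : MeasurableSet A) :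
    Measurable fun x => ContKernel.kernel k x A :=
  ContKernel.kernel_measurable_coe k hA

instance isProbabilityMeasure_kernel_apply (k : X ⟶ Y) (x : X.carrier) :
    IsProbabilityMeasure (ContKernel.kernel k x) :=
  (ContKernel.isMarkov k).1 x

lemma comp_hom_apply (k : X ⟶ Y) (l : Y ⟶ Z) (x : X.carrier) {A : Set Z.carrier}
    (hA : MeasurableSet A) :
    ContKernel.kernel (k ≫ l) x A = ∫⁻ y, ContKernel.kernel l y A ∂ContKernel.kernel k x :=
  ContKernel.comp_apply_open l k x hA

/-- Change of variables along `y ↦ (y, w)`. With its mirror image below, this turns an axiom written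
with whiskerings into an equality of integrals. -/
lemma whiskerRight_comp_apply (k : X ⟶ Y) (l : Y ⊗ W ⟶ Z) (p : X.carrier × W.carrier)
    {A : Set Z.carrier} (hA : MeasurableSet A) :
    ContKernel.kernel (k ▷ W ≫ l) p A
      = ∫⁻ y, ContKernel.kernel l (y, p.2) A ∂ContKernel.kernel k p.1 := by
  refine (comp_hom_apply (k ▷ W) l p hA).trans ?_
  rw [whiskerRight_hom_apply]
  exact lintegral_map (measurable_kernel_apply l hA) (borelMeasurable (Continuous.prodMk_left p.2))

lemma whiskerLeft_comp_apply (k : X ⟶ Y) (l : W ⊗ Y ⟶ Z) (p : W.carrier × X.carrier)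
    {A : Set Z.carrier} (hA : MeasurableSet A) :
    ContKernel.kernel (W ◁ k ≫ l) p A
      = ∫⁻ y, ContKernel.kernel l (p.1, y) A ∂ContKernel.kernel k p.2 := by
  refine (comp_hom_apply (W ◁ k) l p hA).trans ?_
  rw [whiskerLeft_hom_apply]
  exact lintegral_map (measurable_kernel_apply l hA) (borelMeasurable (Continuous.prodMk_right p.1))

/-! ### Deterministic kernels -/

lemma deterministic_diracHom (f : X.carrier → Y.carrier) (hf : Continuous f) :
    Deterministic (diracHom f hf) where
  hom_counit := MarkovCategory.discard_natural _
  hom_comul := by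
    simp only [comul_eq, MonoidalCategory.tensorHom_def, whiskerLeft_diracHom,
      whiskerRight_diracHom, diracHom_comp]
    rfl

/-- A deterministic kernel takes only the values `0` and `1`. -/
lemma kernel_eq_zero_or_one (k : X ⟶ Y) (hk : Deterministic k) (x : X.carrier)
    {A : Set Y.carrier} (hA : MeasurableSet A) :
    ContKernel.kernel k x A = 0 ∨ ContKernel.kernel k x A = 1 := by
  -- The copy equation is tested on the square `A ×ˢ A`: the diagonal pulls it back to `A`, while
  -- independent sampling squares the probability, so `p = p * p`.
  have h := congrArg (fun l : X ⟶ Y ⊗ Y => ContKernel.kernel l x (A ×ˢ A))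
    (Deterministic.copy_natural k)
  have hAA : MeasurableSet (A ×ˢ A) :=
    (borelMeasurable continuous_fst hA).inter (borelMeasurable continuous_snd hA)
  have hd : Measurable fun y : Y.carrier => (y, y) :=
    borelMeasurable (continuous_id.prodMk continuous_id)
  have hl : ContKernel.kernel (k ≫ Δ[Y]) x (A ×ˢ A) = ContKernel.kernel k x A := by
    rw [comul_eq, comp_diracHom_apply]
    refine (Measure.map_apply hd hAA).trans ?_
    congr 1
    ext y
    simp
  have hr : ContKernel.kernel (Δ[X] ≫ (k ⊗ₘ k)) x (A ×ˢ A)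
      = ContKernel.kernel k x A * ContKernel.kernel k x A := by
    rw [comul_eq, diracHom_comp_apply]
    exact tensorHom_prod_apply k k (x, x) hA hA
  have h' : ContKernel.kernel k x A = ContKernel.kernel k x A * ContKernel.kernel k x A :=
    hl.symm.trans (h.trans hr)
  by_cases h0 : ContKernel.kernel k x A = 0
  · exact .inl h0
  · refine .inr ?_
    have := (ENNReal.mul_right_inj h0 (measure_ne_top _ _)).mp ((mul_one _).trans h')
    exact this.symm

/-! ### Saturation and the quotient space -/

lemma trivialAction_eq (G X : TopStoch.{u}) :
    trivialAction G X = diracHom (X := G ⊗ X) Prod.snd continuous_snd := by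
  simp only [trivialAction, counit_eq, leftUnitor_hom_eq, whiskerRight_diracHom, diracHom_comp]
  rfl

/-- The saturation of `U`: the points which some `g` moves into `U`. -/
def saturation (act : G ⊗ X ⟶ X) (U : Set X.carrier) : Set X.carrier :=
  {x | ∃ g : G.carrier, ContKernel.kernel act (g, x) U ≠ 0}

lemma isOpen_act_pos {act : G ⊗ X ⟶ X} {U : Set X.carrier} (hU : IsOpen U) :
    IsOpen {p : G.carrier × X.carrier | 0 < ContKernel.kernel act p U} :=
  (ContKernel.lsc act U hU).isOpen_preimage 0

/-- The saturation is a union over `g` of slices of the set where `act(U|·)` is positive, which is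
open by lower semicontinuity. -/
lemma isOpen_saturation {act : G ⊗ X ⟶ X} {U : Set X.carrier} (hU : IsOpen U) :
    IsOpen (saturation act U) := by
  have : saturation act U
      = ⋃ g : G.carrier, (fun x => (g, x)) ⁻¹' {p | 0 < ContKernel.kernel act p U} := by
    ext x
    simp [saturation, pos_iff_ne_zero]
  rw [this]
  exact isOpen_iUnion fun g => (isOpen_act_pos hU).preimage (Continuous.prodMk_right g)

/-- The identity of `X`, as a map to `X/G`. -/
def toQuotient (act : G ⊗ X ⟶ X) : X.carrier → (quotient act).carrier := fun x => x

lemma continuous_toQuotient (act : G ⊗ X ⟶ X) : Continuous (toQuotient act) :=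
  ⟨fun _ hU => And.left hU⟩

lemma quotientMap_eq (act : G ⊗ X ⟶ X) :
    quotientMap act = diracHom (toQuotient act) (continuous_toQuotient act) := rfl

/-! ### Group and action axioms as integral identities -/

section Action

variable [MarkovGroup G] {act : G ⊗ X ⟶ X}

/-- The associativity axiom evaluated at `(h, g, x)`; `h` acts second, so it is the left factor of
the product. -/
lemma lintegral_act_act (hact : IsMarkovAction act) (g h : G.carrier) (x : X.carrier)
    {A : Set X.carrier} (hA : MeasurableSet A) :
    ∫⁻ y, ContKernel.kernel act (h, y) A ∂ContKernel.kernel act (g, x)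
      = ∫⁻ m, ContKernel.kernel act (m, x) A
          ∂ContKernel.kernel (MarkovGroup.mul : G ⊗ G ⟶ G) (h, g) := by
  have e := congrArg (fun l : G ⊗ G ⊗ X ⟶ X => ContKernel.kernel l (h, g, x) A) hact.assoc
  refine (whiskerLeft_comp_apply act act (h, g, x) hA).symm.trans (e.trans ?_)
  rw [associator_inv_eq, diracHom_comp_apply]
  exact whiskerRight_comp_apply MarkovGroup.mul act ((h, g), x) hA

lemma lintegral_act_one (hact : IsMarkovAction act) (x : X.carrier)
    {A : Set X.carrier} (hA : MeasurableSet A) :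
    ∫⁻ m, ContKernel.kernel act (m, x) A
        ∂ContKernel.kernel (MarkovGroup.one : 𝟙_ TopStoch ⟶ G) PUnit.unit
      = A.indicator 1 x := by
  have e := congrArg (fun l : 𝟙_ TopStoch ⊗ X ⟶ X =>
    ContKernel.kernel l (PUnit.unit, x) A) hact.unit
  refine (whiskerRight_comp_apply MarkovGroup.one act (PUnit.unit, x) hA).symm.trans (e.trans ?_)
  exact Measure.dirac_apply' x hA

/-- Acting with `g` and then with `g⁻¹` returns to the starting point. -/
lemma lintegral_act_inv_act (hact : IsMarkovAction act) (g : G.carrier) (x : X.carrier)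
    {A : Set X.carrier} (hA : MeasurableSet A) :
    ∫⁻ h, ∫⁻ y, ContKernel.kernel act (h, y) A ∂ContKernel.kernel act (g, x)
        ∂ContKernel.kernel (MarkovGroup.inv : G ⟶ G) g = A.indicator 1 x := by
  simp_rw [fun h => lintegral_act_act hact g h x hA]
  -- Following a kernel into `G` by `s ≫ act` lets its value act on the fixed point `x`; this
  -- carries the inverse law in `G` over to `X`.
  let s : G ⟶ G ⊗ X := diracHom (Y := G ⊗ X) (fun m => (m, x)) (Continuous.prodMk_left x)
  have e := congrArg (fun l : G ⟶ G => ContKernel.kernel (l ≫ s ≫ act) g A)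
    (MarkovGroup.inv_mul (G := G))
  have hs : ∀ m, ContKernel.kernel (s ≫ act) m A = ContKernel.kernel act (m, x) A :=
    fun m => by rw [diracHom_comp_apply]
  have hl : ContKernel.kernel ((Δ[G] ≫ MarkovGroup.inv ▷ G ≫ MarkovGroup.mul) ≫ s ≫ act) g A
      = ∫⁻ h, ∫⁻ m, ContKernel.kernel act (m, x) A
          ∂ContKernel.kernel (MarkovGroup.mul : G ⊗ G ⟶ G) (h, g)
        ∂ContKernel.kernel (MarkovGroup.inv : G ⟶ G) g := by
    rw [Category.assoc, Category.assoc, comul_eq, diracHom_comp_apply]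
    refine (whiskerRight_comp_apply MarkovGroup.inv (MarkovGroup.mul ≫ s ≫ act) (g, g) hA).trans ?_
    refine lintegral_congr fun h => ?_
    refine (comp_hom_apply MarkovGroup.mul (s ≫ act) (h, g) hA).trans ?_
    exact lintegral_congr hs
  have hr : ContKernel.kernel ((ε[G] ≫ MarkovGroup.one) ≫ s ≫ act) g A = A.indicator 1 x := by
    rw [Category.assoc, counit_eq, diracHom_comp_apply]
    refine (comp_hom_apply MarkovGroup.one (s ≫ act) PUnit.unit hA).trans ?_
    exact (lintegral_congr hs).trans (lintegral_act_one hact x hA)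
  exact hl.symm.trans (e.trans hr)

/-- Almost every point reached from `x` by `g` lies in `U` and stays there under any further
element, in particular under samples from the inverse of `g`. These bring it back to `x`. -/
lemma IsInvariantOpen.mem_of_act_eq_one (hact : IsMarkovAction act) {U : Set X.carrier}
    (hU : IsInvariantOpen act U) {g : G.carrier} {x : X.carrier}
    (h : ContKernel.kernel act (g, x) U = 1) : x ∈ U := by
  have hm := hU.1.borelMeasurableSet
  have e := lintegral_act_inv_act hact g x hm
  have hae : ∀ᵐ y ∂ContKernel.kernel act (g, x), y ∈ U := (mem_ae_iff_prob_eq_one hm).mpr h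
  have h1 : ∀ h', ∫⁻ y, ContKernel.kernel act (h', y) U ∂ContKernel.kernel act (g, x) = 1 := by
    intro h'
    rw [lintegral_congr_ae (g := fun _ => 1) (hae.mono fun y hy => hU.2 h' y hy)]
    simp
  simp_rw [h1] at e
  by_contra hx
  simp [hx] at e

lemma IsInvariantOpen.act_apply (hact : IsMarkovAction act) {U : Set X.carrier}
    (hU : IsInvariantOpen act U) (g : G.carrier) (x : X.carrier) :
    ContKernel.kernel act (g, x) U = U.indicator 1 x := by
  by_cases hx : x ∈ U
  · simpa [hx] using hU.2 g x hx
  · rcases kernel_eq_zero_or_one act hact.deterministic (g, x) hU.1.borelMeasurableSet with h | h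
    · simpa [hx] using h
    · exact absurd (hU.mem_of_act_eq_one hact h) hx

/-- If no group element moved `x` into `U`, neither would a sample from the unit, although that
fixes `x`. -/
lemma subset_saturation (hact : IsMarkovAction act) {U : Set X.carrier} (hU : IsOpen U) :
    U ⊆ saturation act U := by
  intro x hx
  by_contra hn
  have h0 : ∀ g : G.carrier, ContKernel.kernel act (g, x) U = 0 := by
    simpa [saturation] using hn
  have e := lintegral_act_one hact x hU.borelMeasurableSet
  simp [h0, hx] at e

/-- If `h` moved `x` out of the saturation, a sample from the inverse of `h` would have to bring it
back from there; but no element moves an outside point to where a fixed `g` can carry it into `U`.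
-/
lemma isInvariantOpen_saturation (hact : IsMarkovAction act) {U : Set X.carrier}
    (hU : IsOpen U) : IsInvariantOpen act (saturation act U) := by
  have hS := isOpen_saturation (act := act) hU
  refine ⟨hS, fun h x ⟨g, hg⟩ => ?_⟩
  refine (kernel_eq_zero_or_one act hact.deterministic (h, x)
    hS.borelMeasurableSet).resolve_left fun h0 => ?_
  -- `V` keeps the witness `g` fixed: it contains `x`, yet points outside the saturation are never
  -- moved into it.
  let V : Set X.carrier := {z | 0 < ContKernel.kernel act (g, z) U}
  have hV : MeasurableSet V :=
    ((isOpen_act_pos hU).preimage (Continuous.prodMk_right g)).borelMeasurableSet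
  have hout : ∀ (h' : G.carrier), ∀ y ∉ saturation act U,
      ContKernel.kernel act (h', y) V = 0 := by
    intro h' y hy
    have hy0 : ∀ m : G.carrier, ContKernel.kernel act (m, y) U = 0 := by
      simpa [saturation] using hy
    have e := lintegral_act_act hact h' g y hU.borelMeasurableSet
    -- Acting with `h'` and then `g` on `y` is acting with a sample from their product, and no
    -- element moves `y` into `U`.
    simp_rw [hy0, lintegral_zero] at e
    have hm : Measurable fun z => ContKernel.kernel act (g, z) U :=
      (measurable_kernel_apply act hU.borelMeasurableSet).comp
        (borelMeasurable (Continuous.prodMk_right g))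
    have hae := (lintegral_eq_zero_iff hm).mp e
    refine measure_mono_null (fun z hz => ?_) hae
    exact ne_of_gt hz
  have e := lintegral_act_inv_act hact h x hV
  have hae : ∀ᵐ y ∂ContKernel.kernel act (h, x), y ∉ saturation act U :=
    measure_eq_zero_iff_ae_notMem.mp h0
  have hz : ∀ h' : G.carrier,
      ∫⁻ y, ContKernel.kernel act (h', y) V ∂ContKernel.kernel act (h, x) = 0 := by
    intro h'
    rw [lintegral_congr_ae (g := fun _ => 0) (hae.mono fun y hy => hout h' y hy)]
    simp
  simp_rw [hz] at e
  have hxV : x ∈ V := pos_iff_ne_zero.mpr hg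
  simp [hxV] at e

/-! ### Invariance of the quotient map and descent of functions -/

lemma act_comp_quotientMap (hact : IsMarkovAction act) :
    act ≫ quotientMap act = trivialAction G X ≫ quotientMap act := by
  -- Kernels into `X/G` need only be compared on its open sets, the invariant ones, where
  -- `IsInvariantOpen.act_apply` makes `act` agree with the Dirac measure.
  refine ContKernel.ext_open fun p U hU => ?_
  have hU' : IsInvariantOpen act U := hU
  have hl : ContKernel.kernel (act ≫ quotientMap act) p U = ContKernel.kernel act p U := by
    rw [quotientMap_eq, comp_diracHom_apply]
    exact Measure.map_apply (borelMeasurable (continuous_toQuotient act)) hU.borelMeasurableSet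
  have hr : ContKernel.kernel (trivialAction G X ≫ quotientMap act) p U
      = U.indicator 1 (toQuotient act p.2) := by
    rw [trivialAction_eq, diracHom_comp_apply]
    exact Measure.dirac_apply' (toQuotient act p.2) hU.borelMeasurableSet
  exact hl.trans ((hU'.act_apply hact p.1 p.2).trans hr.symm)

/-- The superlevel sets of an invariant function are invariant. -/
lemma isInvariantOpen_superlevel (hact : IsMarkovAction act) {f : X.carrier → ℝ≥0∞}
    (hf : LowerSemicontinuous f)
    (h : ∀ (g : G.carrier) (x : X.carrier), ∫⁻ y, f y ∂ContKernel.kernel act (g, x) = f x)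
    (t : ℝ≥0∞) : IsInvariantOpen act {x | t < f x} := by
  have ho : IsOpen {x | t < f x} := hf.isOpen_preimage t
  refine ⟨ho, fun g x hx => ?_⟩
  refine (kernel_eq_zero_or_one act hact.deterministic (g, x)
    ho.borelMeasurableSet).resolve_left fun h0 => ?_
  -- If the superlevel set had measure `0`, the average of `f`, which is `f x`, would be at most
  -- `t`.
  have hae : ∀ᵐ y ∂ContKernel.kernel act (g, x), f y ≤ t :=
    (measure_eq_zero_iff_ae_notMem.mp h0).mono fun y hy => not_lt.mp hy
  have hle : f x ≤ t := by
    rw [← h g x]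
    refine (lintegral_mono_ae hae).trans ?_
    simp
  exact absurd hx (not_lt.mpr hle)

/-- A function on `X × W` which is lower semicontinuous and invariant in the first variable is
lower semicontinuous on `X/G × W`. -/
lemma lowerSemicontinuous_quotient_prod (hact : IsMarkovAction act) {W : Type*}
    [TopologicalSpace W] {f : X.carrier × W → ℝ≥0∞} (hf : LowerSemicontinuous f)
    (h : ∀ (g : G.carrier) (x : X.carrier) (w : W),
      ∫⁻ y, f (y, w) ∂ContKernel.kernel act (g, x) = f (x, w)) :
    @LowerSemicontinuous ((quotient act).carrier × W) _ _ _ f := by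
  refine (lowerSemicontinuous_iff_isOpen_preimage
    (α := (quotient act).carrier × W)).mpr fun t => ?_
  refine isOpen_prod_iff.mpr fun x w hxw => ?_
  obtain ⟨A, B, hA, hB, hxA, hwB, hs⟩ := isOpen_prod_iff.mp (hf.isOpen_preimage t) x w hxw
  -- Saturating the first side of the rectangle makes it a neighbourhood for the topology of `X/G`;
  -- it remains to see that it still lies in the superlevel set.
  refine ⟨saturation (X := X) act A, B, isInvariantOpen_saturation hact hA, hB,
    subset_saturation hact hA hxA, hwB, ?_⟩
  rintro ⟨x', w'⟩ ⟨⟨g, hg⟩, hw'⟩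
  -- The slice at `w'` is invariant and contains `A`. Since `g` moves `x'` into `A` with nonzero
  -- probability, it moves `x'` into the slice with probability `1`, so `x'` already lies there.
  have hinv : IsInvariantOpen act {z | t < f (z, w')} :=
    isInvariantOpen_superlevel hact (hf.comp (Continuous.prodMk_left w')) (fun g x => h g x w') t
  refine hinv.mem_of_act_eq_one hact (g := g) ?_
  refine (kernel_eq_zero_or_one act hact.deterministic (g, x')
    hinv.1.borelMeasurableSet).resolve_left fun h0 => hg ?_
  have hsub : A ⊆ {z | t < f (z, w')} := fun z hz => hs (Set.mk_mem_prod hz hw')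
  exact measure_mono_null hsub h0

end Action

/-! ### The universal property -/

lemma epi_diracHom {f : X.carrier → Y.carrier} (hf : Continuous f) (hs : Function.Surjective f) :
    Epi (diracHom f hf) where
  -- Precomposition with a Dirac kernel is evaluation at `f x`, and these values exhaust the target.
  left_cancellation k l h := hom_ext_apply fun y => by
    obtain ⟨x, rfl⟩ := hs y
    rw [← diracHom_comp_apply _ _ hf, h, diracHom_comp_apply]

/-- For an epimorphism uniqueness of the factorisation is free, so existence suffices. -/
lemma isCoequaliser_of_epi {f g : X ⟶ Y} {q : Y ⟶ Z} [Epi q] (w : f ≫ q = g ≫ q)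
    (h : ∀ {T : TopStoch.{u}} (k : Y ⟶ T), f ≫ k = g ≫ k → ∃ l : Z ⟶ T, q ≫ l = k) :
    IsCoequaliser f g q :=
  ⟨w, ⟨Limits.Cofork.IsColimit.mk _ (fun s => (h s.π s.condition).choose)
    (fun s => (h s.π s.condition).choose_spec)
    fun s _ hm => (cancel_epi q).mp (hm.trans (h s.π s.condition).choose_spec.symm)⟩⟩

lemma isOrbitMap_quotientMap [MarkovGroup G] (act : G ⊗ X ⟶ X) (hact : IsMarkovAction act) :
    IsOrbitMap act (quotientMap act) where
  deterministic := deterministic_diracHom _ _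
  coequaliser := by
    have : Epi (quotientMap act) := epi_diracHom _ fun x => ⟨x, rfl⟩
    refine isCoequaliser_of_epi (act_comp_quotientMap hact) fun {T} k hk => ?_
    have hinv : ∀ (U : Set T.carrier), IsOpen U → ∀ (g : G.carrier) (x : X.carrier),
        ∫⁻ y, ContKernel.kernel k y U ∂ContKernel.kernel act (g, x) = ContKernel.kernel k x U := by
      intro U hU g x
      have e := congrArg (fun l : G ⊗ X ⟶ T => ContKernel.kernel l (g, x) U) hk
      refine (comp_hom_apply act k (g, x) hU.borelMeasurableSet).symm.trans (e.trans ?_)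
      rw [trivialAction_eq, diracHom_comp_apply]
    -- The measures are those of `k`; only the topology of the source is coarser. Measurability for
    -- its smaller Borel σ-algebra is not inherited from `k` but follows from the new lower
    -- semicontinuity.
    let l : quotient act ⟶ T := ContKernel.ofFun
      (fun x : (quotient act).carrier => ContKernel.kernel k x)
      (fun x => isProbabilityMeasure_kernel_apply k x) (fun x => ContKernel.tauSmooth k x)
      fun U hU => lowerSemicontinuous_iff_isOpen_preimage.mpr fun t =>
        isInvariantOpen_superlevel hact (ContKernel.lsc k U hU) (hinv U hU) t
    refine ⟨l, hom_ext_apply fun x => ?_⟩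
    rw [quotientMap_eq, diracHom_comp_apply]
    rfl
  preserved Y := by
    have hq : quotientMap act ▷ Y = diracHom (X := X ⊗ Y) (Y := quotient act ⊗ Y) _ _ :=
      whiskerRight_diracHom Y _ _
    have : Epi (quotientMap act ▷ Y) := by
      rw [hq]
      exact epi_diracHom _ fun p => ⟨p, rfl⟩
    refine isCoequaliser_of_epi ?_ fun {T} k hk => ?_
    · rw [← wr_comp, ← wr_comp, act_comp_quotientMap hact]
    have hinv : ∀ (U : Set T.carrier), IsOpen U →
        ∀ (g : G.carrier) (x : X.carrier) (w : Y.carrier),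
        ∫⁻ y, ContKernel.kernel k (y, w) U ∂ContKernel.kernel act (g, x)
          = ContKernel.kernel k (x, w) U := by
      intro U hU g x w
      have e := congrArg (fun l : (G ⊗ X) ⊗ Y ⟶ T => ContKernel.kernel l ((g, x), w) U) hk
      refine (whiskerRight_comp_apply act k ((g, x), w) hU.borelMeasurableSet).symm.trans
        (e.trans ?_)
      rw [trivialAction_eq, whiskerRight_diracHom, diracHom_comp_apply]
      rfl
    -- Again the measures of `k`, now needing joint lower semicontinuity on `X/G × Y`, which is
    -- where saturation enters.
    let l : quotient act ⊗ Y ⟶ T := ContKernel.ofFun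
      (fun p : (quotient act).carrier × Y.carrier => ContKernel.kernel k p)
      (fun p => isProbabilityMeasure_kernel_apply k p) (fun p => ContKernel.tauSmooth k p)
      fun U hU => lowerSemicontinuous_quotient_prod hact (ContKernel.lsc k U hU) (hinv U hU)
    refine ⟨l, hom_ext_apply fun p => ?_⟩
    rw [hq, diracHom_comp_apply]
    rfl

end Borel

end TopStoch

theorem mainTheorem2 {G X : TopStoch.{u}} [MarkovGroup G] (act : G ⊗ X ⟶ X)
    (hact : IsMarkovAction act) :
    (∃ (Q : TopStoch.{u}) (q : X ⟶ Q), IsOrbitMap act q) ∧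
      IsOrbitMap act (TopStoch.quotientMap act) :=
  ⟨⟨_, _, TopStoch.isOrbitMap_quotientMap act hact⟩, TopStoch.isOrbitMap_quotientMap act hact⟩
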